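/- Let $V$ be a finite-dimensional complex vector space and $G\subset GL(V)$ a connected closed real semisimple matrix Lie group with trivial center whose Lie algebra $\mathfrak g$ satisfies $\mathfrak g\cap i\mathfrak g=0$, so that $\mathfrak g^{\mathbb C}=\mathfrak g\oplus i\mathfrak g\subset\mathrm{End}(V)$. Let $h\in G$ be such that $\sigma(g)=hgh^{-1}$ satisfies $\sigma^2=\mathrm{id}$ on $G$, let $\hat K=\mathrm{Fix}^\sigma(G)$, and let $\mathfrak g=\mathfrak k\oplus\mathfrak p$ be the decomposition into the $\pm1$-eigenspaces of $d\sigma$. Let $\Lambda G$ be the group of smooth loops $S^1\to G$ and $\Omega G=\{\gamma\in\Lambda G:\gamma(1)=e\}$. Let $M$ be a Riemann surface, $\mathcal F:M\to G/\hat K$ a harmonic map, $X$ a connected Riemann surface and $p:X\to M$ a holomorphic map (for example the universal covering $X=\tilde M$ of $M$), and let $z_0\in X$. Let $F:X\to G$ be a smooth frame of $\mathcal F\circ p$, i.e. $F(z)\hat K=\mathcal F(p(z))$, with $F(z_0)=e$, and put $\alpha=F^{-1}dF=\alpha_{\mathfrak k}+\alpha_{\mathfrak p}$. Let $F(z,\lambda)\in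 GL(V)$, $\lambda\in\mathbb C^*$, be the extended frame, i.e. smooth in $z$ with $$dF(z,\lambda)=F(z,\lambda)\,\bigl(\lambda^{-1}\alpha_{\mathfrak p}'+\alpha_{\mathfrak k}+\lambda\alpha_{\mathfrak p}''\bigr),\qquad F(z_0,\lambda)=e,$$ where $'$ and $''$ denote the $(1,0)$- and $(0,1)$-parts, and put $\mathbb F(z)=F(z,1)\,h\,F(z,1)^{-1}$. Let $\Phi(z,1,\lambda)\in GL(V)$, $z\in X$, $\lambda\in\mathbb C^*$, be smooth in $z$ and solve Uhlenbeck's system for $\mathbb F$, $$\partial_z\Phi\,dz=(1-\lambda^{-1})\,\Phi\,\mathbb A^{(1,0)},\qquad \partial_{\bar z}\Phi\,d\bar z=(1-\lambda)\,\Phi\,\mathbb A^{(0,1)},\qquad \mathbb A=\tfrac12\mathbb F^{-1}d\mathbb F,$$ and suppose that at the base point $\Phi(z_0,1,\cdot)|_{S^1}\in\Omega G$ and $\Phi(z_0,1,-1)=h$. (Every extended solution of $\mathbb F$, that is, every solution with $\Phi(z,1,\cdot)\in\Omega G$ and $\Phi(z,1,-1)=\mathbb F(z)$ for all $z$, has these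 properties.) Put $A(1,\lambda)=\Phi(z_0,1,\lambda)^{-1}$. Then: 1. $F(z,\cdot)|_{S^1}$ belongs to $\Lambda G$ and is $\sigma$-twisted, $\sigma(F(z,\lambda))=F(z,-\lambda)$, for all $z\in X$; and $\mathbb F$ is a modified harmonic map, i.e. a harmonic map $X\to G$ with $\mathbb F^2=e$ and $\mathbb F(z_0)=h$. 2. $\Phi(z,1,\lambda)=A(1,\lambda)^{-1}F(z,\lambda)F(z,1)^{-1}$ for all $z\in X$ and $\lambda\in\mathbb C^*$. 3. $\Phi(z,1,\cdot)|_{S^1}\in\Omega G$ for all $z\in X$. 4. $\Phi(z,1,-1)=\mathbb F(z)=F(z,1)\,h\,F(z,1)^{-1}$ for all $z\in X$. -/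

import Mathlib

open Complex
open scoped Manifold ContDiff Topology 

noncomputable section

namespace HarmonicLoop

attribute [local instance] LieRing.ofAssociativeRing

/-- The complex square matrices, as the algebra of all endomorphisms of a finite dimensional complex
vector space `V`. -/
abbrev Mat (V : Type*) [NormedAddCommGroup V] [NormedSpace ℂ V] := V →L[ℂ] V

/-- The general linear group of `V`. -/
abbrev GLin (V : Type*) [NormedAddCommGroup V] [NormedSpace ℂ V] := (V →L[ℂ] V)ˣ

variable {V : Type*} [NormedAddCommGroup V] [NormedSpace ℂ V]

/-! ### Matrix Lie groups -/

/-- The Lie algebra of a closed matrix group `G`: the set of all `X` with `exp (tX) ∈ G` for every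
real `t`. For closed `G` this set is a real Lie algebra, so that `lieSpan` adds nothing to it. -/
def lieAlgebra (G : Subgroup (GLin V)) : LieSubalgebra ℝ (Mat V) :=
  LieSubalgebra.lieSpan ℝ (Mat V)
    {X | ∀ t : ℝ, ∃ g ∈ G, (g : Mat V) = NormedSpace.exp (t • X)}

/-- `G` is a connected real semisimple matrix Lie group with trivial center. The condition
`total_real` says that `𝔤 ⊗ ℂ → 𝔤 + i 𝔤` is an isomorphism, so that the complexification of `𝔤` is
formed inside the complex matrices. -/
structure IsSemisimpleMatrixGroup (G : Subgroup (GLin V)) : Prop where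
  closed : IsClosed (G : Set (GLin V))
  connected : IsConnected (G : Set (GLin V))
  semisimple : LieAlgebra.IsSemisimple ℝ (lieAlgebra G)
  center_trivial : Subgroup.center G = ⊥
  total_real : ∀ X ∈ lieAlgebra G, I • X ∈ lieAlgebra G → X = 0

/-- The inner automorphism `σ (g) = h g h⁻¹` of `G`. -/
def sigma {G : Subgroup (GLin V)} (h : G) : G ≃* G := MulAut.conj h

/-- The fixed point group `K̂ = Fix^σ(G)`. -/
def fixSigma {G : Subgroup (GLin V)} (h : G) : Subgroup G :=
  (sigma h).toMonoidHom.eqLocus (MonoidHom.id G)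

/-- The differential of `σ` on matrices. -/
def dsigma {G : Subgroup (GLin V)} (h : G) (X : Mat V) : Mat V :=
  ((h : GLin V) : Mat V) * X * (((h : GLin V)⁻¹ : GLin V) : Mat V)

/-- The component in the `+1` eigenspace of `dσ`. -/
def kPart {G : Subgroup (GLin V)} (h : G) (X : Mat V) : Mat V :=
  (1 / 2 : ℂ) • (X + dsigma h X)

/-- The component in the `-1` eigenspace of `dσ`. -/
def pPart {G : Subgroup (GLin V)} (h : G) (X : Mat V) : Mat V :=
  (1 / 2 : ℂ) • (X - dsigma h X)

/-! ### Loop groups -/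

/-- The loop group `ΛG` of smooth loops `S¹ → G`. -/
def loopGroup [FiniteDimensional ℂ V] (G : Subgroup (GLin V)) : Subgroup (Circle → GLin V) where
  carrier := {γ | (∀ l, γ l ∈ G) ∧
    ContDiff ℝ ∞ (fun θ : ℝ => ((γ (Circle.exp θ) : GLin V) : Mat V))}
  one_mem' := ⟨fun _ => G.one_mem, by simpa using contDiff_const⟩
  mul_mem' := by
    rintro a b ⟨ha, ha'⟩ ⟨hb, hb'⟩
    exact ⟨fun l => G.mul_mem (ha l) (hb l), ha'.mul hb'⟩
  inv_mem' := by
    rintro a ⟨ha, ha'⟩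
    refine ⟨fun l => G.inv_mem (ha l), ?_⟩
    have key : (fun θ : ℝ => (((a⁻¹) (Circle.exp θ) : GLin V) : Mat V)) =
        fun θ : ℝ => Ring.inverse ((a (Circle.exp θ) : GLin V) : Mat V) := by
      funext θ
      simp only [Pi.inv_apply]
      exact (Ring.inverse_unit (a (Circle.exp θ))).symm
    rw [key]
    have : CompleteSpace V := FiniteDimensional.complete ℂ V
    refine contDiff_iff_contDiffAt.2 fun θ => ?_
    exact (contDiffAt_ringInverse ℝ (a (Circle.exp θ))).comp θ ha'.contDiffAt

/-- The based loop group `ΩG`. -/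
def basedLoopGroup [FiniteDimensional ℂ V] (G : Subgroup (GLin V)) : Subgroup (Circle → GLin V) where
  carrier := {γ | γ ∈ loopGroup G ∧ γ 1 = 1}
  one_mem' := ⟨Subgroup.one_mem _, rfl⟩
  mul_mem' := by
    rintro a b ⟨ha, ha'⟩ ⟨hb, hb'⟩
    exact ⟨Subgroup.mul_mem _ ha hb, by simp [ha', hb']⟩
  inv_mem' := by
    rintro a ⟨ha, ha'⟩
    exact ⟨Subgroup.inv_mem _ ha, by simp [ha']⟩

/-- A loop is `σ`-twisted if `σ (γ (l)) = γ (-l)`. -/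
def IsTwisted {G : Subgroup (GLin V)} (h : G) (γ : Circle → GLin V) : Prop :=
  ∀ l, (h : GLin V) * γ l * (h : GLin V)⁻¹ = γ (-l)

/-- Restriction of a map on `ℂ^*` to the unit circle. -/
def onCircle (γ : ℂˣ → GLin V) : Circle → GLin V :=
  fun l => γ (Circle.toUnits l)

/-! ### Matrix valued functions and one-forms on a Riemann surface

The real tangent space of a Riemann surface at a point is `ℂ` (through the preferred chart), and its
complex structure is multiplication by `i`. -/

section Surface

variable {X : Type*} [TopologicalSpace X] [ChartedSpace ℂ X]

/-- Smoothness over `ℝ`, on a set, of a map into the invertible matrices. -/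
def SmoothOn (f : X → GLin V) (U : Set X) : Prop :=
  ContMDiffOn 𝓘(ℝ, ℂ) 𝓘(ℝ, Mat V) ∞ (fun x => (f x : Mat V)) U

/-- The real differential `df` of a map into the invertible matrices. -/
def diff (f : X → GLin V) (x : X) : ℂ →L[ℝ] Mat V :=
  mfderiv 𝓘(ℝ, ℂ) 𝓘(ℝ, Mat V) (fun y => (f y : Mat V)) x

/-- The Maurer-Cartan form `f⁻¹ df`. -/
def maurerCartan (f : X → GLin V) (x : X) (v : ℂ) : Mat V :=
  (((f x)⁻¹ : GLin V) : Mat V) * diff f x v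

/-- The `(1,0)`-part of a real linear form on a tangent space. -/
def part10 (β : ℂ → Mat V) (v : ℂ) : Mat V := (1 / 2 : ℂ) • (β v - I • β (I * v))

/-- The `(0,1)`-part of a real linear form on a tangent space. -/
def part01 (β : ℂ → Mat V) (v : ℂ) : Mat V := (1 / 2 : ℂ) • (β v + I • β (I * v))

/-- The Maurer-Cartan form `f⁻¹ ∂_c f` in a chart `e`, in the real coordinate direction `c`. -/
def mcChart (e : OpenPartialHomeomorph X ℂ) (f : X → GLin V) (c w : ℂ) : Mat V :=
  (((f (e.symm w))⁻¹ : GLin V) : Mat V) *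
    fderiv ℝ (fun u : ℂ => (f (e.symm u) : Mat V)) w c

/-! ### Harmonic maps -/

/-- A harmonic map into the group `G` with its bi-invariant metric: in every holomorphic coordinate
`u + iv` the equation `∂_u (f⁻¹ ∂_u f) + ∂_v (f⁻¹ ∂_v f) = 0` holds, that is `d * (f⁻¹ df) = 0`. -/
def IsHarmonicIntoGroup (G : Subgroup (GLin V)) (f : X → GLin V) : Prop :=
  (∀ x, f x ∈ G) ∧ SmoothOn f Set.univ ∧
    ∀ e ∈ atlas ℂ X, ∀ w ∈ e.target,
      fderiv ℝ (mcChart e f 1) w 1 + fderiv ℝ (mcChart e f I) w I = 0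

/-- The covariant derivative `∂_c (α_𝔭 (∂_c)) + [α_𝔨 (∂_c), α_𝔭 (∂_c)]` in a chart, where `α` is
the Maurer-Cartan form of `f`. -/
def covDeriv {G : Subgroup (GLin V)} (h : G) (e : OpenPartialHomeomorph X ℂ)
    (f : X → GLin V) (c w : ℂ) : Mat V :=
  fderiv ℝ (fun u : ℂ => pPart h (mcChart e f c u)) w c +
    ⁅kPart h (mcChart e f c w), pPart h (mcChart e f c w)⁆

/-- A harmonic map into the symmetric space `G/K̂` with its invariant metric: locally there are smooth
lifts `f` to `G`, and for them the tension field, which is `f` applied to the sum of the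
covariant derivatives of `α_𝔭` in the two real coordinate directions, vanishes. -/
def IsHarmonicIntoSymmetricSpace {G : Subgroup (GLin V)} (h : G)
    (φ : X → G ⧸ fixSigma h) : Prop :=
  ∀ x, ∃ U : Set X, IsOpen U ∧ x ∈ U ∧ ∃ f : X → G,
    SmoothOn (fun y => (f y : GLin V)) U ∧
    (∀ y ∈ U, (QuotientGroup.mk (f y) : G ⧸ fixSigma h) = φ y) ∧
    ∀ e ∈ atlas ℂ X, ∀ w ∈ e.target, e.symm w ∈ U →
      covDeriv h e (fun y => (f y : GLin V)) 1 w +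
        covDeriv h e (fun y => (f y : GLin V)) I w = 0

/-- `f` is a (smooth, global) frame of `φ`, normalized to `e` at `x₀`. -/
structure IsFrame {G : Subgroup (GLin V)} (h : G) (φ : X → G ⧸ fixSigma h) (x₀ : X)
    (f : X → G) : Prop where
  smooth : SmoothOn (fun y => (f y : GLin V)) Set.univ
  lift : ∀ x, (QuotientGroup.mk (f x) : G ⧸ fixSigma h) = φ x
  base : f x₀ = 1

/-- The form `α_l = l⁻¹ α_𝔭' + α_𝔨 + l α_𝔭''`, where `α = f⁻¹ df`. -/
def alphaLoop {G : Subgroup (GLin V)} (h : G) (f : X → G) (l : ℂˣ) (x : X) (v : ℂ) : Mat V :=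
  let α : ℂ → Mat V := maurerCartan (fun y => (f y : GLin V)) x
  (l : ℂ)⁻¹ • part10 (fun u => pPart h (α u)) v + kPart h (α v) +
    (l : ℂ) • part01 (fun u => pPart h (α u)) v

/-- `F` is the extended frame belonging to the frame `f`: it solves `dF = F α_l`, `F (x₀, l) = e`,
for all `l ∈ ℂ^*`. -/
structure IsExtendedFrame {G : Subgroup (GLin V)} (h : G) (f : X → G) (x₀ : X)
    (F : X → ℂˣ → GLin V) : Prop where
  smooth : ∀ l, SmoothOn (fun x => F x l) Set.univ
  eqn : ∀ l x v, diff (fun y => F y l) x v = (F x l : Mat V) * alphaLoop h f l x v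
  base : ∀ l, F x₀ l = 1

/-- The map `𝔽 = F h F⁻¹` at `l = 1`. -/
def modifiedMap {G : Subgroup (GLin V)} (h : G) (F : X → ℂˣ → GLin V) (x : X) :
    GLin V :=
  F x 1 * (h : GLin V) * (F x 1)⁻¹

/-- A modified harmonic map: a harmonic map into `G` with square `e` and value `h` at `x₀`. -/
structure IsModifiedHarmonicMap {G : Subgroup (GLin V)} (h : G) (x₀ : X)
    (f : X → GLin V) : Prop where
  harmonic : IsHarmonicIntoGroup G f
  sq : ∀ x, f x * f x = 1
  base : f x₀ = h

/-- Uhlenbeck's system for `f`, for all `l ∈ ℂ^*`, with `𝔸 = (1/2) f⁻¹ df`: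
`∂_z Φ dz = (1 - l⁻¹) Φ 𝔸^(1,0)` and `∂_z̄ Φ dz̄ = (1 - l) Φ 𝔸^(0,1)`. -/
structure SolvesUhlenbeck (f : X → GLin V) (Φ : X → ℂˣ → GLin V) : Prop where
  smooth : ∀ l, SmoothOn (fun x => Φ x l) Set.univ
  eqn10 : ∀ l x v, part10 (fun u => diff (fun y => Φ y l) x u) v =
    (1 - (l : ℂ)⁻¹) • ((Φ x l : Mat V) *
      part10 (fun u => (1 / 2 : ℂ) • maurerCartan f x u) v)
  eqn01 : ∀ l x v, part01 (fun u => diff (fun y => Φ y l) x u) v =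
    (1 - (l : ℂ)) • ((Φ x l : Mat V) *
      part01 (fun u => (1 / 2 : ℂ) • maurerCartan f x u) v)

end Surface

end HarmonicLoop

end

/-! Everything reduces to linear equations `dΨ = Ψ β` on the connected surface, whose solutions are
determined by one value, because `Ψ₁ Ψ₂⁻¹` has zero differential (`eq_of_diff_eq_mul`). Since the
center is trivial, `σ² = id` forces `h² = 1`. Differentiating `𝔽 = F h F⁻¹` at `λ = 1` then gives `𝔸
= -F α_𝔭 F⁻¹` (`maurerCartan_modifiedMap`). Hence Uhlenbeck's system is `dΦ = Φ · F (α_λ - α_1) F⁻¹`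
with `F = F(·, 1)`. The product `Φ(z₀, λ) F(z, λ) F(z, 1)⁻¹` solves the same equation with the same
value at `z₀`; this is the formula for `Φ`. Twistedness is again uniqueness, since `dσ α_λ =
α_{-λ}`. The value at `-1` follows from the formula and twistedness.

For `|λ| = 1` the form `α_λ` is a real combination of values of `α_𝔨` and `α_𝔭`, hence tangent to
`G`. The distance to `G` along a solution then obeys a Gronwall inequality with zero initial value,
so the solution stays in the closed group (`mem_of_hasDerivAt_tangentSet`). Smoothness of the loops
comes from holomorphic dependence on `λ` (`differentiableAt_of_hasDerivAt_parameter`).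

Harmonicity of `𝔽` is read off from the existence of `Φ`: the integrability conditions at `λ = i`
and `λ = -i` have the same commutator term, and their difference is `d * (𝔽⁻¹ d𝔽) = 0`
(`SolvesUhlenbeck.isHarmonic`).

Tangency to `G` is expressed by velocities of curves (`tangentSet`). Only sums, real multiples and
conjugates are needed, so neither the exponential map nor the bracket enters. -/

noncomputable section

namespace HarmonicLoop

open Filter Set

/-! ### Invariance of a closed matrix group under tangent equations -/

section Units

variable {R : Type*} [NormedRing R] [NormedAlgebra ℝ R]

/-- The velocities at the identity of differentiable curves in `G`. -/
def tangentSet (G : Subgroup Rˣ) : Set R :=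
  {Y | ∃ c : ℝ → Rˣ, (∀ t, c t ∈ G) ∧ c 0 = 1 ∧ HasDerivAt (fun t => (c t : R)) Y 0}

variable {G : Subgroup Rˣ}

theorem tangentSet_add {Y Z : R} (hY : Y ∈ tangentSet G) (hZ : Z ∈ tangentSet G) :
    Y + Z ∈ tangentSet G := by
  obtain ⟨c, hc, hc0, hc'⟩ := hY
  obtain ⟨d, hd, hd0, hd'⟩ := hZ
  refine ⟨fun t => c t * d t, fun t => G.mul_mem (hc t) (hd t), by simp [hc0, hd0], ?_⟩
  simpa [hc0, hd0] using hc'.fun_mul hd'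

theorem tangentSet_smul (r : ℝ) {Y : R} (hY : Y ∈ tangentSet G) : r • Y ∈ tangentSet G := by
  obtain ⟨c, hc, hc0, hc'⟩ := hY
  refine ⟨fun t => c (r * t), fun t => hc _, by simp [hc0], ?_⟩
  have h1 : HasDerivAt (fun t : ℝ => r * t) r 0 := by
    simpa using (hasDerivAt_id (0 : ℝ)).const_mul r
  have h2 : HasDerivAt (fun t => (c t : R)) Y (r * 0) := by simpa using hc'
  exact h2.scomp (0 : ℝ) h1

theorem tangentSet_conj {g : Rˣ} (hg : g ∈ G) {Y : R} (hY : Y ∈ tangentSet G) :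
    (g : R) * Y * ((g⁻¹ : Rˣ) : R) ∈ tangentSet G := by
  obtain ⟨c, hc, hc0, hc'⟩ := hY
  refine ⟨fun t => g * c t * g⁻¹, fun t => G.mul_mem (G.mul_mem hg (hc t)) (G.inv_mem hg),
    by simp [hc0], ?_⟩
  simpa using (hc'.const_mul (g : R)).mul_const ((g⁻¹ : Rˣ) : R)

/-- The distance to a subgroup grows at most exponentially along a solution of `γ' = γ a` with `a`
tangent to the subgroup. -/
theorem frequently_infDist_lt {γ : ℝ → R} {Y : R} {t : ℝ} (hY : Y ∈ tangentSet G)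
    (hγ : HasDerivAt γ (γ t * Y) t) {r : ℝ}
    (hr : ‖Y‖ * Metric.infDist (γ t) ((↑) '' (G : Set Rˣ)) < r) :
    ∃ᶠ z in 𝓝[>] t, (z - t)⁻¹ * (Metric.infDist (γ z) ((↑) '' (G : Set Rˣ)) -
      Metric.infDist (γ t) ((↑) '' (G : Set Rˣ))) < r := by
  obtain ⟨c, hc, hc0, hc'⟩ := hY
  set S : Set R := (↑) '' (G : Set Rˣ)
  have hS : S.Nonempty := ⟨1, 1, G.one_mem, rfl⟩
  set D := Metric.infDist (γ t) S
  have hsub : HasDerivAt (fun z : ℝ => z - t) 1 t := (hasDerivAt_id t).sub_const t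
  have hc1 : HasDerivAt (fun z => (c (z - t) : R)) Y t := by
    have h2 : HasDerivAt (fun t => (c t : R)) Y (t - t) := by simpa using hc'
    simpa [Function.comp_def] using HasDerivAt.scomp (h := fun z : ℝ => z - t) t h2 hsub
  -- To first order `γ` agrees at `t` with the right translate `γ t * c (z - t)` of a curve in `G`.
  have h1 : HasDerivAt (fun z => γ z - γ t * (c (z - t) : R)) 0 t := by
    simpa using hγ.fun_sub (hc1.const_mul (γ t))
  have l1 := (hasDerivAt_iff_tendsto_slope.1 h1).norm
  have l2 := (hasDerivAt_iff_tendsto_slope.1 hc1).norm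
  have l3 : Tendsto (fun z => ‖slope (fun z => γ z - γ t * (c (z - t) : R)) t z‖ +
      D * ‖slope (fun z => (c (z - t) : R)) t z‖) (𝓝[>] t) (𝓝 (‖(0 : R)‖ + D * ‖Y‖)) :=
    (l1.add (l2.const_mul D)).mono_left (nhdsWithin_mono _ fun z hz => ne_of_gt hz)
  have hr' : ‖(0 : R)‖ + D * ‖Y‖ < r := by rw [norm_zero, zero_add, mul_comm]; exact hr
  refine Eventually.frequently ?_
  filter_upwards [l3.eventually (gt_mem_nhds hr'), self_mem_nhdsWithin] with z hz hzt
  refine lt_of_le_of_lt ?_ hz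
  have hzt' : 0 < z - t := sub_pos.2 hzt
  have e1 : ‖slope (fun z => γ z - γ t * (c (z - t) : R)) t z‖ =
      (z - t)⁻¹ * ‖γ z - γ t * (c (z - t) : R)‖ := by
    rw [slope_def_module, norm_smul, norm_inv, Real.norm_of_nonneg hzt'.le]
    simp [hc0]
  have e2 : ‖slope (fun z => (c (z - t) : R)) t z‖ = (z - t)⁻¹ * ‖(c (z - t) : R) - 1‖ := by
    rw [slope_def_module, norm_smul, norm_inv, Real.norm_of_nonneg hzt'.le]
    simp [hc0]
  rw [e1, e2]
  have key : Metric.infDist (γ z) S ≤ ‖γ z - γ t * (c (z - t) : R)‖ +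
      D * (1 + ‖(c (z - t) : R) - 1‖) := by
    have hb : ∀ s ∈ S, Metric.infDist (γ z) S - ‖γ z - γ t * (c (z - t) : R)‖ ≤
        dist (γ t) s * (1 + ‖(c (z - t) : R) - 1‖) := by
      rintro _ ⟨g, hg, rfl⟩
      -- A competitor `g` for the distance at time `t` is moved along with the curve: `g * c (z -
      -- t)` is still in `G`.
      have m1 : Metric.infDist (γ z) S ≤ dist (γ z) ((g * c (z - t) : Rˣ) : R) :=
        Metric.infDist_le_dist_of_mem ⟨_, G.mul_mem hg (hc _), rfl⟩
      have m2 : γ z - ((g * c (z - t) : Rˣ) : R) = (γ z - γ t * (c (z - t) : R)) +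
          ((γ t - g) + (γ t - g) * ((c (z - t) : R) - 1)) := by
        push_cast
        noncomm_ring
      rw [dist_eq_norm, m2] at m1
      have m3 := norm_add_le (γ z - γ t * (c (z - t) : R))
        ((γ t - g) + (γ t - g) * ((c (z - t) : R) - 1))
      have m4 := norm_add_le (γ t - g) ((γ t - g) * ((c (z - t) : R) - 1))
      have m5 := norm_mul_le (γ t - g) ((c (z - t) : R) - 1)
      rw [dist_eq_norm]
      linarith
    -- Dividing by this factor turns the bound over all `s ∈ S` into a lower bound for the infimum
    -- `D`.
    have hp : 0 < 1 + ‖(c (z - t) : R) - 1‖ := by positivity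
    have := (Metric.le_infDist (x := γ t) (r := (Metric.infDist (γ z) S -
      ‖γ z - γ t * (c (z - t) : R)‖) / (1 + ‖(c (z - t) : R) - 1‖)) hS).2
      fun {s} hs => (div_le_iff₀ hp).2 (hb s hs)
    have := (div_le_iff₀ hp).1 this
    linarith
  have : (z - t)⁻¹ * ‖γ z - γ t * (c (z - t) : R)‖ + D * ((z - t)⁻¹ * ‖(c (z - t) : R) - 1‖) =
      (z - t)⁻¹ * (‖γ z - γ t * (c (z - t) : R)‖ + D * ‖(c (z - t) : R) - 1‖) := by ring
  rw [this]
  gcongr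
  linarith

variable [CompleteSpace R]

theorem hasFDerivAt_units_inv {E : Type*} [NormedAddCommGroup E] [NormedSpace ℝ E]
    {c : E → Rˣ} {c' : E →L[ℝ] R} {x : E} (hc : HasFDerivAt (fun y => (c y : R)) c' x) :
    HasFDerivAt (fun y => (((c y)⁻¹ : Rˣ) : R))
      ((-ContinuousLinearMap.mulLeftRight ℝ R ((c x)⁻¹ : Rˣ) ((c x)⁻¹ : Rˣ)).comp c') x := by
  have h := (hasFDerivAt_ringInverse (𝕜 := ℝ) (c x)).comp x hc
  have he : (fun y => (((c y)⁻¹ : Rˣ) : R)) = Ring.inverse ∘ fun y => (c y : R) := by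
    funext y
    simp
  rw [he]
  exact h

theorem hasDerivAt_units_inv {c : ℝ → Rˣ} {c' : R} {t : ℝ}
    (hc : HasDerivAt (fun s => (c s : R)) c' t) :
    HasDerivAt (fun s => (((c s)⁻¹ : Rˣ) : R))
      (-(((c t)⁻¹ : Rˣ) * c' * ((c t)⁻¹ : Rˣ) : R)) t := by
  have h := (hasFDerivAt_units_inv hc.hasFDerivAt).hasDerivAt
  simpa using h

theorem contDiffAt_units_inv {E : Type*} [NormedAddCommGroup E] [NormedSpace ℝ E]
    {c : E → Rˣ} {x : E} {n : WithTop ℕ∞} (hc : ContDiffAt ℝ n (fun y => (c y : R)) x) :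
    ContDiffAt ℝ n (fun y => (((c y)⁻¹ : Rˣ) : R)) x := by
  have he : (fun y => (((c y)⁻¹ : Rˣ) : R)) = Ring.inverse ∘ fun y => (c y : R) := by
    funext y
    simp
  rw [he]
  exact (contDiffAt_ringInverse ℝ (c x)).comp x hc

/-- A solution of `γ' = γ a` with `a` tangent to the closed group `G` stays in `G`. -/
theorem mem_of_hasDerivAt_tangentSet (hG : IsClosed (G : Set Rˣ)) {γ : ℝ → Rˣ} {a : ℝ → R}
    (hγ : ∀ t ∈ Icc (0 : ℝ) 1, HasDerivAt (fun s => (γ s : R)) (γ t * a t) t)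
    (ha : ContinuousOn a (Icc 0 1)) (haG : ∀ t ∈ Icc (0 : ℝ) 1, a t ∈ tangentSet G)
    (h0 : γ 0 ∈ G) : γ 1 ∈ G := by
  obtain ⟨K, hK⟩ := isCompact_Icc.exists_bound_of_continuousOn ha
  set S : Set R := (↑) '' (G : Set Rˣ)
  have hS : S.Nonempty := ⟨1, 1, G.one_mem, rfl⟩
  have hcont : ContinuousOn (fun t => Metric.infDist (γ t : R) S) (Icc 0 1) :=
    (Metric.continuous_infDist_pt S).comp_continuousOn
      fun t ht => (hγ t ht).continuousAt.continuousWithinAt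
  have hm : (γ 0 : R) ∈ S := ⟨γ 0, h0, rfl⟩
  have hz : Metric.infDist (γ 0 : R) S ≤ 0 := (Metric.infDist_zero_of_mem hm).le
  -- The distance need not be differentiable, hence the Gronwall lemma for lower right slopes; with
  -- `δ = ε = 0` its bound is zero.
  have hd := le_gronwallBound_of_liminf_deriv_right_le hcont
    (f' := fun t => ‖a t‖ * Metric.infDist (γ t : R) S) (K := K) (ε := 0) (δ := 0)
    (fun t ht r hr => frequently_infDist_lt (γ := fun s => (γ s : R)) (haG t ⟨ht.1, ht.2.le⟩)
      (hγ t ⟨ht.1, ht.2.le⟩) hr) hz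
    (fun t ht => by
      rw [add_zero]
      exact mul_le_mul_of_nonneg_right (hK t ⟨ht.1, ht.2.le⟩) Metric.infDist_nonneg)
    1 ⟨zero_le_one, le_rfl⟩
  rw [gronwallBound_ε0, zero_mul] at hd
  have hcl : (γ 1 : R) ∈ closure S :=
    (Metric.mem_closure_iff_infDist_zero (s := S) hS).2 (le_antisymm hd Metric.infDist_nonneg)
  -- `G` is closed among the units only. As `γ 1` is a unit and the units carry the induced
  -- topology, closure in `R` suffices.
  have hcl' : γ 1 ∈ closure (G : Set Rˣ) := by
    rw [(Units.isOpenEmbedding_val (R := R)).isInducing.closure_eq_preimage_closure_image]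
    exact hcl
  rwa [hG.closure_eq] at hcl'

end Units

/-! ### Holomorphic dependence on the loop parameter -/

section Parameter

variable {R : Type*} [NormedRing R] [NormedAlgebra ℂ R] [CompleteSpace R]

/-- The comparison of the solutions of `T' = T (z⁻¹ b + c + z d)` for two values of `z`. -/
theorem mul_inv_sub_one_eq_smul_integral {T : ℝ → ℂ → Rˣ} {b c d : ℝ → R}
    (hT : ∀ z ≠ 0, ∀ t ∈ Icc (0 : ℝ) 1,
      HasDerivAt (fun s => (T s z : R)) (T t z * (z⁻¹ • b t + c t + z • d t)) t)
    (hb : ContinuousOn b (Icc 0 1)) (hd : ContinuousOn d (Icc 0 1))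
    (h0 : ∀ z, T 0 z = 1) {z w : ℂ} (hz : z ≠ 0) (hw : w ≠ 0) {t : ℝ} (ht : t ∈ Icc (0 : ℝ) 1) :
    ContinuousOn (fun s => (T s w : R) * (d s - (w * z)⁻¹ • b s) * ((T s z)⁻¹ : Rˣ)) (Icc 0 1) ∧
    (T t w : R) * ((T t z)⁻¹ : Rˣ) - 1 =
      (w - z) • ∫ s in (0 : ℝ)..t, (T s w : R) * (d s - (w * z)⁻¹ • b s) * ((T s z)⁻¹ : Rˣ) := by
  have hc1 : ContinuousOn (fun s => (T s w : R)) (Icc 0 1) := fun s hs =>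
    (hT w hw s hs).continuousAt.continuousWithinAt
  have hc2 : ContinuousOn (fun s => (((T s z)⁻¹ : Rˣ) : R)) (Icc 0 1) := fun s hs =>
    (hasDerivAt_units_inv (hT z hz s hs)).continuousAt.continuousWithinAt
  have hc : ContinuousOn (fun s => (T s w : R) * (d s - (w * z)⁻¹ • b s) * ((T s z)⁻¹ : Rˣ))
      (Icc 0 1) := (hc1.mul (hd.sub (hb.const_smul _))).mul hc2
  refine ⟨hc, ?_⟩
  have hsub : uIcc 0 t ⊆ Icc (0 : ℝ) 1 := by
    rw [uIcc_of_le ht.1]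
    exact Icc_subset_Icc_right ht.2
  -- Variation of constants: the derivative is `T_w (a_w - a_z) T_z⁻¹` with `a_z = z⁻¹ b + c + z d`,
  -- and `w - z` divides `a_w - a_z` exactly.
  have hder : ∀ s ∈ uIcc 0 t, HasDerivAt (fun s => (T s w : R) * ((T s z)⁻¹ : Rˣ))
      ((w - z) • ((T s w : R) * (d s - (w * z)⁻¹ • b s) * ((T s z)⁻¹ : Rˣ))) s := by
    intro s hs
    have h1 := (hT w hw s (hsub hs)).fun_mul (hasDerivAt_units_inv (hT z hz s (hsub hs)))
    refine h1.congr_deriv ?_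
    have e1 : (((T s z)⁻¹ : Rˣ) : R) * (T s z * (z⁻¹ • b s + c s + z • d s)) * ((T s z)⁻¹ : Rˣ) =
        (z⁻¹ • b s + c s + z • d s) * ((T s z)⁻¹ : Rˣ) := by
      rw [Units.inv_mul_cancel_left]
    have e2 : (w - z) • (d s - (w * z)⁻¹ • b s) =
        (w⁻¹ • b s + c s + w • d s) - (z⁻¹ • b s + c s + z • d s) := by
      have : (w - z) * (w * z)⁻¹ = z⁻¹ - w⁻¹ := by field_simp
      rw [smul_sub, smul_smul, this]
      module
    rw [e1, ← smul_mul_assoc, ← mul_smul_comm, e2]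
    noncomm_ring
  have := intervalIntegral.integral_eq_sub_of_hasDerivAt hder
    ((hc.mono hsub).const_smul _).intervalIntegrable
  rw [intervalIntegral.integral_smul] at this
  rw [this]
  simp [h0]

/-- Solutions of `T' = T (z⁻¹ b + c + z d)` depend holomorphically on `z`. -/
theorem differentiableAt_of_hasDerivAt_parameter {T : ℝ → ℂ → Rˣ} {b c d : ℝ → R}
    (hT : ∀ z ≠ 0, ∀ t ∈ Icc (0 : ℝ) 1,
      HasDerivAt (fun s => (T s z : R)) (T t z * (z⁻¹ • b t + c t + z • d t)) t)
    (hb : ContinuousOn b (Icc 0 1)) (hc : ContinuousOn c (Icc 0 1))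
    (hd : ContinuousOn d (Icc 0 1)) (h0 : ∀ z, T 0 z = 1) {z : ℂ} (hz : z ≠ 0) :
    DifferentiableAt ℂ (fun w => (T 1 w : R)) z := by
  obtain ⟨Kb, hKb⟩ := isCompact_Icc.exists_bound_of_continuousOn hb
  obtain ⟨Kc, hKc⟩ := isCompact_Icc.exists_bound_of_continuousOn hc
  obtain ⟨Kd, hKd⟩ := isCompact_Icc.exists_bound_of_continuousOn hd
  obtain ⟨Kz, hKz⟩ := isCompact_Icc.exists_bound_of_continuousOn
    (fun s hs => (hasDerivAt_units_inv (hT z hz s hs)).continuousAt.continuousWithinAt :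
      ContinuousOn (fun s => (((T s z)⁻¹ : Rˣ) : R)) (Icc 0 1))
  have h01 : (0 : ℝ) ∈ Icc (0 : ℝ) 1 := ⟨le_rfl, zero_le_one⟩
  have h11 : (1 : ℝ) ∈ Icc (0 : ℝ) 1 := ⟨zero_le_one, le_rfl⟩
  have pb : 0 ≤ Kb := (norm_nonneg _).trans (hKb 0 h01)
  have pc : 0 ≤ Kc := (norm_nonneg _).trans (hKc 0 h01)
  have pd : 0 ≤ Kd := (norm_nonneg _).trans (hKd 0 h01)
  have pz : 0 ≤ Kz := (norm_nonneg _).trans (hKz 0 h01)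
  set B : ℝ := ‖z⁻¹‖ + 1
  set N : ℝ := ‖z‖ + 1
  -- Gronwall bound for `T s w`, uniform in `s` and in `w` near `z`; `B` and `N` bound `‖w⁻¹‖` and
  -- `‖w‖` there.
  set E : ℝ := ‖(1 : R)‖ * Real.exp (B * Kb + Kc + N * Kd)
  set q : ℂ → ℝ → R := fun w s => (T s w : R) * (d s - (w * z)⁻¹ • b s) * ((T s z)⁻¹ : Rˣ)
  set C : ℝ := E * (Kd + B * ‖z⁻¹‖ * Kb) * Kz
  have near : ∀ᶠ w in 𝓝 z, w ≠ 0 ∧ ‖w⁻¹‖ < B ∧ ‖w‖ < N := by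
    refine (eventually_ne_nhds hz).and (Eventually.and ?_ ?_)
    · exact (continuousAt_inv₀ hz).norm.eventually (gt_mem_nhds (by simp [B]))
    · exact continuous_norm.continuousAt.eventually (gt_mem_nhds (by simp [N]))
  have bdT : ∀ w : ℂ, w ≠ 0 ∧ ‖w⁻¹‖ < B ∧ ‖w‖ < N → ∀ s ∈ Icc (0 : ℝ) 1, ‖(T s w : R)‖ ≤ E := by
    rintro w ⟨hw, hwB, hwN⟩ s hs
    have hg := norm_le_gronwallBound_of_norm_deriv_right_le (f := fun s => (T s w : R))
      (f' := fun t => T t w * (w⁻¹ • b t + c t + w • d t)) (δ := ‖(1 : R)‖)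
      (K := B * Kb + Kc + N * Kd) (ε := 0) (a := 0) (b := 1)
      (fun s hs => (hT w hw s hs).continuousAt.continuousWithinAt)
      (fun s hs => (hT w hw s ⟨hs.1, hs.2.le⟩).hasDerivWithinAt) (by simp [h0])
      (fun t ht => by
        have ht' : t ∈ Icc (0 : ℝ) 1 := ⟨ht.1, ht.2.le⟩
        rw [add_zero, mul_comm]
        refine (norm_mul_le _ _).trans (mul_le_mul_of_nonneg_left ?_ (norm_nonneg _))
        refine (norm_add₃_le).trans ?_
        rw [norm_smul, norm_smul]
        have := hKb t ht'
        have := hKc t ht'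
        have := hKd t ht'
        gcongr) s hs
    rw [gronwallBound_ε0, sub_zero] at hg
    refine hg.trans ?_
    have : 0 ≤ B * Kb + Kc + N * Kd := by positivity
    refine mul_le_mul_of_nonneg_left (Real.exp_le_exp.2 ?_) (norm_nonneg _)
    exact mul_le_of_le_one_right this hs.2
  have pE : 0 ≤ E := by positivity
  have bdq : ∀ w : ℂ, w ≠ 0 ∧ ‖w⁻¹‖ < B ∧ ‖w‖ < N → ∀ s ∈ Icc (0 : ℝ) 1, ‖q w s‖ ≤ C := by
    intro w hw s hs
    refine (norm_mul_le _ _).trans (mul_le_mul ?_ (hKz s hs) (norm_nonneg _) (by positivity))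
    refine (norm_mul_le _ _).trans (mul_le_mul (bdT w hw s hs) ?_ (norm_nonneg _) pE)
    refine (norm_sub_le _ _).trans (add_le_add (hKd s hs) ?_)
    rw [norm_smul, mul_inv, norm_mul]
    have := hKb s hs
    have := hw.2.1.le
    gcongr
  have key : ∀ w : ℂ, w ≠ 0 → ∀ t ∈ Icc (0 : ℝ) 1,
      (T t w : R) = T t z + (w - z) • ((∫ s in (0 : ℝ)..t, q w s) * T t z) := by
    intro w hw t ht
    have h1 := (mul_inv_sub_one_eq_smul_integral hT hb hd h0 hz hw ht).2
    have h2 : (T t w : R) = ((T t w : R) * ((T t z)⁻¹ : Rˣ) - 1) * T t z + T t z := by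
      rw [sub_mul, Units.inv_mul_cancel_right, one_mul, sub_add_cancel]
    rw [h2, h1, smul_mul_assoc, add_comm]
  -- Continuity in the parameter comes first: it gives the pointwise convergence of `q w` needed for
  -- dominated convergence. The difference quotient at time `1` is the integral of `q w` times `T 1
  -- z`.
  have limT : ∀ t ∈ Icc (0 : ℝ) 1, Tendsto (fun w => (T t w : R)) (𝓝 z) (𝓝 (T t z)) := by
    intro t ht
    rw [tendsto_iff_norm_sub_tendsto_zero]
    have lim0 : Tendsto (fun w : ℂ => ‖w - z‖ * (C * ‖(T t z : R)‖)) (𝓝 z) (𝓝 0) := by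
      have : Continuous fun w : ℂ => ‖w - z‖ * (C * ‖(T t z : R)‖) := by fun_prop
      simpa using this.tendsto z
    refine squeeze_zero' (Eventually.of_forall fun _ => norm_nonneg _) ?_ lim0
    filter_upwards [near] with w hw
    rw [key w hw.1 t ht, add_sub_cancel_left, norm_smul]
    refine mul_le_mul_of_nonneg_left ?_ (norm_nonneg _)
    refine (norm_mul_le _ _).trans (mul_le_mul_of_nonneg_right ?_ (norm_nonneg _))
    have hi := intervalIntegral.norm_integral_le_of_norm_le_const (f := q w) (C := C)
      (a := 0) (b := t) (fun s hs => by
        rw [uIoc_of_le ht.1] at hs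
        exact bdq w hw s ⟨hs.1.le, hs.2.trans ht.2⟩)
    refine hi.trans ?_
    rw [sub_zero, abs_of_nonneg ht.1]
    exact mul_le_of_le_one_right (by positivity) ht.2
  have limQ : Tendsto (fun w => ∫ s in (0 : ℝ)..1, q w s) (𝓝 z) (𝓝 (∫ s in (0 : ℝ)..1, q z s)) := by
    have hsub : Set.uIoc (0 : ℝ) 1 ⊆ Icc 0 1 := by
      rw [uIoc_of_le zero_le_one]
      exact Ioc_subset_Icc_self
    refine intervalIntegral.tendsto_integral_filter_of_dominated_convergence (fun _ => C) ?_ ?_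
      intervalIntegrable_const ?_
    · filter_upwards [near] with w hw
      exact ((mul_inv_sub_one_eq_smul_integral hT hb hd h0 hz hw.1 h11).1.mono
        hsub).aestronglyMeasurable measurableSet_uIoc
    · filter_upwards [near] with w hw
      exact Eventually.of_forall fun s hs => bdq w hw s (hsub hs)
    · refine Eventually.of_forall fun s hs => ?_
      refine ((limT s (hsub hs)).mul (Tendsto.sub tendsto_const_nhds ?_)).mul tendsto_const_nhds
      refine Tendsto.smul_const ?_ _
      exact ((continuous_id.mul continuous_const).continuousAt (x := z)).inv₀
        (mul_ne_zero hz hz)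
  have hd' : HasDerivAt (fun w => (T 1 w : R)) ((∫ s in (0 : ℝ)..1, q z s) * T 1 z) z := by
    rw [hasDerivAt_iff_tendsto_slope]
    refine ((limQ.mul_const (T 1 z : R)).mono_left nhdsWithin_le_nhds).congr' ?_
    filter_upwards [self_mem_nhdsWithin, nhdsWithin_le_nhds near] with w hwz hw
    have hne : w - z ≠ 0 := sub_ne_zero.2 hwz
    rw [slope_def_module, key w hw.1 1 h11, add_sub_cancel_left, smul_smul, inv_mul_cancel₀ hne,
      one_smul]
  exact hd'.differentiableAt

end Parameter

/-! ### Differentials in an arbitrary chart -/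

section Charts

variable {V : Type*} [NormedAddCommGroup V] [NormedSpace ℂ V]
  {X : Type*} [TopologicalSpace X] [ChartedSpace ℂ X]

theorem smoothOn_univ_iff {f : X → GLin V} :
    SmoothOn f univ ↔ ∀ x, ContinuousAt (fun y => (f y : Mat V)) x ∧
      ContDiffAt ℝ ∞ (fun u => (f ((chartAt ℂ x).symm u) : Mat V)) (chartAt ℂ x x) := by
  unfold SmoothOn
  rw [contMDiffOn_univ]
  refine forall_congr' fun x => ?_
  rw [contMDiffAt_iff]
  simp only [mfld_simps, contDiffWithinAt_univ, Function.comp_def]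
  exact Iff.rfl

theorem diff_eq_fderiv {f : X → GLin V} (hf : SmoothOn f univ) (x : X) :
    diff f x = fderiv ℝ (fun u => (f ((chartAt ℂ x).symm u) : Mat V)) (chartAt ℂ x x) := by
  have h : MDifferentiableAt 𝓘(ℝ, ℂ) 𝓘(ℝ, Mat V) (fun y => (f y : Mat V)) x :=
    (contMDiffOn_univ.1 hf x).mdifferentiableAt (by simp)
  unfold diff
  refine h.mfderiv.trans ?_
  simp only [mfld_simps, fderivWithin_univ, Function.comp_def, writtenInExtChartAt]
  rfl

variable [IsManifold 𝓘(ℂ) ω X]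

theorem contDiffAt_chart_change {e : OpenPartialHomeomorph X ℂ} (he : e ∈ atlas ℂ X) {w : ℂ}
    (hw : w ∈ e.target) {e' : OpenPartialHomeomorph X ℂ} (he' : e' ∈ atlas ℂ X)
    (hw' : e.symm w ∈ e'.source) : ContDiffAt ℂ ω (fun u => e' (e.symm u)) w := by
  have h := (contDiffGroupoid ω 𝓘(ℂ)).compatible he he'
  rw [contDiffGroupoid, mem_groupoid_of_pregroupoid] at h
  have h1 := h.1
  simp only [contDiffPregroupoid, mfld_simps] at h1
  have hs : e.target ∩ e.symm ⁻¹' e'.source ∈ 𝓝 w :=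
    (e.symm.isOpen_inter_preimage e'.open_source).mem_nhds ⟨hw, hw'⟩
  refine (ContDiffOn.contDiffAt ?_ hs)
  simpa [Function.comp_def] using h1

/-- The derivative of the transition from the chart `e` to the preferred chart. -/
def chartVelocity (e : OpenPartialHomeomorph X ℂ) (w : ℂ) : ℂ :=
  deriv (fun u => chartAt ℂ (e.symm w) (e.symm u)) w

/-- The differential `diff` refers to the preferred chart at each point, which varies with the
point. Chart changes are holomorphic, so passing to a fixed chart is multiplication by a complex
number and commutes with the complex structure. -/
theorem hasFDerivAt_comp_chart_symm {f : X → GLin V} (hf : SmoothOn f univ)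
    {e : OpenPartialHomeomorph X ℂ} (he : e ∈ atlas ℂ X) {w : ℂ} (hw : w ∈ e.target) :
    ContDiffAt ℝ ∞ (fun u => (f (e.symm u) : Mat V)) w ∧
    ∀ v, fderiv ℝ (fun u => (f (e.symm u) : Mat V)) w v =
      diff f (e.symm w) (chartVelocity e w * v) := by
  set x := e.symm w with hx
  set e' := chartAt ℂ x
  have hc := contDiffAt_chart_change he hw (chart_mem_atlas ℂ x) (mem_chart_source ℂ x)
  have h1 := (smoothOn_univ_iff.1 hf x).2
  have heq : (fun u => (f (e.symm u) : Mat V)) =ᶠ[𝓝 w]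
      (fun u => (f (e'.symm u) : Mat V)) ∘ fun u => e' (e.symm u) := by
    have : e.target ∩ e.symm ⁻¹' e'.source ∈ 𝓝 w :=
      (e.symm.isOpen_inter_preimage e'.open_source).mem_nhds ⟨hw, mem_chart_source ℂ x⟩
    filter_upwards [this] with u hu
    simp [e'.left_inv hu.2]
  have hcR : ContDiffAt ℝ ∞ (fun u => e' (e.symm u)) w := (hc.restrict_scalars ℝ).of_le le_top
  refine ⟨(ContDiffAt.comp w h1 hcR).congr_of_eventuallyEq heq, fun v => ?_⟩
  have hd : HasFDerivAt (fun u => e' (e.symm u))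
      ((ContinuousLinearMap.toSpanSingleton ℂ (chartVelocity e w)).restrictScalars ℝ) w :=
    (hc.differentiableAt (by simp)).hasDerivAt.hasFDerivAt.restrictScalars ℝ
  have h2 := (h1.differentiableAt (by simp)).hasFDerivAt
  have h3 := h2.comp w hd
  rw [heq.fderiv_eq, h3.fderiv, diff_eq_fderiv hf]
  simp [mul_comm]

end Charts

/-! ### Product and inverse rules for group-valued maps -/

section Calculus

variable {V : Type*} [NormedAddCommGroup V] [NormedSpace ℂ V]
  {X : Type*} [TopologicalSpace X] [ChartedSpace ℂ X]

theorem smoothOn_const (g : GLin V) : SmoothOn (fun _ : X => g) univ :=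
  contMDiffOn_const

theorem diff_const (g : GLin V) (x : X) (v : ℂ) : diff (fun _ : X => g) x v = 0 := by
  rw [diff_eq_fderiv (smoothOn_const g)]
  simp

theorem SmoothOn.mul {f g : X → GLin V} (hf : SmoothOn f univ) (hg : SmoothOn g univ) :
    SmoothOn (fun x => f x * g x) univ := by
  rw [smoothOn_univ_iff] at *
  exact fun x => ⟨(hf x).1.mul (hg x).1, (hf x).2.mul (hg x).2⟩

theorem diff_mul {f g : X → GLin V} (hf : SmoothOn f univ) (hg : SmoothOn g univ) (x : X) (v : ℂ) :
    diff (fun x => f x * g x) x v = diff f x v * g x + f x * diff g x v := by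
  have h1 := ((smoothOn_univ_iff.1 hf x).2.differentiableAt (by simp)).hasFDerivAt
  have h2 := ((smoothOn_univ_iff.1 hg x).2.differentiableAt (by simp)).hasFDerivAt
  rw [diff_eq_fderiv hf, diff_eq_fderiv hg, diff_eq_fderiv (hf.mul hg)]
  have h3 := (h1.mul' h2).fderiv
  have e : (fun u => ((f ((chartAt ℂ x).symm u) * g ((chartAt ℂ x).symm u) : GLin V) : Mat V)) =
      (fun u => (f ((chartAt ℂ x).symm u) : Mat V)) * fun u => (g ((chartAt ℂ x).symm u) : Mat V) :=
    rfl
  rw [e, h3]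
  simp [add_comm]

variable [CompleteSpace V]

theorem SmoothOn.inv {f : X → GLin V} (hf : SmoothOn f univ) :
    SmoothOn (fun x => (f x)⁻¹) univ := by
  rw [smoothOn_univ_iff] at *
  refine fun x => ⟨?_, contDiffAt_units_inv (hf x).2⟩
  have h : ContinuousAt f x := Units.isOpenEmbedding_val.isInducing.continuousAt_iff.2 (hf x).1
  exact Units.continuous_val.continuousAt.comp h.inv

theorem diff_inv {f : X → GLin V} (hf : SmoothOn f univ) (x : X) (v : ℂ) :
    diff (fun x => (f x)⁻¹) x v = -(((f x)⁻¹ : GLin V) * diff f x v * ((f x)⁻¹ : GLin V) : Mat V) := by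
  have h := (diff_mul hf hf.inv x v).symm
  simp only [mul_inv_cancel, diff_const] at h
  have h2 := eq_neg_of_add_eq_zero_right h
  rw [← Units.inv_mul_cancel_left (f x) (diff (fun x => (f x)⁻¹) x v), h2, mul_neg, mul_assoc]

end Calculus

/-! ### Paths and uniqueness for linear systems on a connected surface -/

section Segments

variable {V : Type*} [NormedAddCommGroup V] [NormedSpace ℂ V]
  {X : Type*} [TopologicalSpace X] [ChartedSpace ℂ X]

variable (V) in
/-- `τ` is the velocity of the path `c : [0, 1] → X`, as seen by functions with values in
the invertible matrices. -/
def IsVelocity (c : ℝ → X) (τ : ℝ → ℂ) : Prop :=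
  ∀ f : X → GLin V, SmoothOn f univ →
    (∀ t ∈ Icc (0 : ℝ) 1, HasDerivAt (fun s => (f (c s) : Mat V)) (diff f (c t) (τ t)) t) ∧
    ∀ z : ℂ, ContinuousOn (fun t => diff f (c t) (z * τ t)) (Icc 0 1)

variable [IsManifold 𝓘(ℂ) ω X]

/-- The preferred chart may jump along the segment, so the velocity itself need not be continuous.
Its pairing with `diff f` is, because in the fixed chart `e` it is the ordinary derivative of `f`.
-/
theorem isVelocity_segment {e : OpenPartialHomeomorph X ℂ} (he : e ∈ atlas ℂ X) {w₀ w₁ : ℂ}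
    (hw : ∀ t ∈ Icc (0 : ℝ) 1, w₀ + (t : ℂ) * (w₁ - w₀) ∈ e.target) :
    IsVelocity V (fun t => e.symm (w₀ + (t : ℂ) * (w₁ - w₀)))
      fun t => chartVelocity e (w₀ + (t : ℂ) * (w₁ - w₀)) * (w₁ - w₀) := by
  intro f hf
  refine ⟨fun t ht => ?_, fun z => ?_⟩
  · obtain ⟨h1, h2⟩ := hasFDerivAt_comp_chart_symm hf he (hw t ht)
    have hl : HasDerivAt (fun t : ℝ => w₀ + (t : ℂ) * (w₁ - w₀)) (w₁ - w₀) t := by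
      simpa using ((Complex.ofRealCLM.hasDerivAt (x := t)).mul_const (w₁ - w₀)).const_add w₀
    rw [← h2]
    exact (h1.differentiableAt (by simp)).hasFDerivAt.comp_hasDerivAt t hl
  · intro t ht
    obtain ⟨h1, -⟩ := hasFDerivAt_comp_chart_symm hf he (hw t ht)
    have hc : ContinuousAt (fun t : ℝ => w₀ + (t : ℂ) * (w₁ - w₀)) t := by fun_prop
    have hfd : ContinuousAt (fderiv ℝ (fun u => (f (e.symm u) : Mat V)))
        (w₀ + (t : ℂ) * (w₁ - w₀)) := (h1.fderiv_right (m := 0) (by simp)).continuousAt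
    have h3 : ContinuousAt (fun t : ℝ => fderiv ℝ (fun u => (f (e.symm u) : Mat V))
        (w₀ + (t : ℂ) * (w₁ - w₀)) (z * (w₁ - w₀))) t :=
      (ContinuousAt.comp (f := fun t : ℝ => w₀ + (t : ℂ) * (w₁ - w₀)) hfd hc).clm_apply
        continuousAt_const
    refine h3.continuousWithinAt.congr (fun s hs => ?_) ?_
    · rw [(hasFDerivAt_comp_chart_symm hf he (hw s hs)).2, mul_left_comm]
    · rw [(hasFDerivAt_comp_chart_symm hf he (hw t ht)).2, mul_left_comm]

/-- A property which is passed on along paths holds everywhere on a connected surface. -/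
theorem path_induction [ConnectedSpace X] {P : X → Prop} {x₀ : X} (h₀ : P x₀)
    (hP : ∀ c τ, IsVelocity V c τ → P (c 0) → P (c 1)) (x : X) : P x := by
  have hseg : ∀ x : X, ∀ᶠ y in 𝓝 x, P x ↔ P y := by
    intro x
    set e := chartAt ℂ x
    obtain ⟨r, hr, hball⟩ := Metric.isOpen_iff.1 e.open_target (e x) (mem_chart_target ℂ x)
    have hstep : ∀ w₀ ∈ Metric.ball (e x) r, ∀ w₁ ∈ Metric.ball (e x) r,
        P (e.symm w₀) → P (e.symm w₁) := by
      intro w₀ hw₀ w₁ hw₁ h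
      have hw : ∀ t ∈ Icc (0 : ℝ) 1, w₀ + (t : ℂ) * (w₁ - w₀) ∈ e.target := by
        intro t ht
        have := (convex_ball (e x) r).add_smul_sub_mem hw₀ hw₁ ht
        rw [Complex.real_smul] at this
        exact hball this
      have := hP _ _ (isVelocity_segment (V := V) (chart_mem_atlas ℂ x) hw)
      simp only [ofReal_zero, zero_mul, add_zero, ofReal_one, one_mul, add_sub_cancel] at this
      exact this h
    have hx : x ∈ e.source := mem_chart_source ℂ x
    have hn : e ⁻¹' Metric.ball (e x) r ∈ 𝓝 x :=
      (e.continuousAt hx).preimage_mem_nhds (Metric.ball_mem_nhds _ hr)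
    filter_upwards [hn, e.open_source.mem_nhds hx] with y hy hys
    have h1 := hstep _ (Metric.mem_ball_self hr) _ hy
    have h2 := hstep _ hy _ (Metric.mem_ball_self hr)
    rw [e.left_inv hx, e.left_inv hys] at h1 h2
    exact ⟨h1, h2⟩
  have : Std.Symm fun x y : X => P x ↔ P y := ⟨fun _ _ h => h.symm⟩
  -- Straight segments in a coordinate disc make `P` locally constant, hence constant by
  -- connectedness.
  exact (PreconnectedSpace.induction₂ (fun x y : X => P x ↔ P y) hseg
    ⟨fun _ _ _ h1 h2 => h1.trans h2⟩ x₀ x).1 h₀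

/-- Solutions of `df = f β` are determined by the value at one point. -/
theorem eq_of_diff_eq_mul [CompleteSpace V] [ConnectedSpace X] {f g : X → GLin V}
    (hf : SmoothOn f univ) (hg : SmoothOn g univ) {β : X → ℂ → Mat V}
    (hfβ : ∀ x v, diff f x v = f x * β x v) (hgβ : ∀ x v, diff g x v = g x * β x v) {x₀ : X}
    (h₀ : f x₀ = g x₀) (x : X) : f x = g x := by
  -- In `d(f g⁻¹) = f β g⁻¹ - f β g⁻¹` the two terms cancel.
  have hk : SmoothOn (fun y => f y * (g y)⁻¹) univ := hf.mul hg.inv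
  have hd : ∀ y v, diff (fun y => f y * (g y)⁻¹) y v = 0 := by
    intro y v
    rw [diff_mul hf hg.inv, diff_inv hg, hfβ, hgβ, Units.inv_mul_cancel_left]
    noncomm_ring
  have hc : f x * (g x)⁻¹ = 1 := by
    refine path_induction (V := V) (P := fun y => f y * (g y)⁻¹ = 1) (x₀ := x₀)
      (by rw [h₀, mul_inv_cancel]) (fun c τ hcτ h => ?_) x
    have h1 := (hcτ _ hk).1
    simp only [hd] at h1
    have := constant_of_has_deriv_right_zero (a := (0 : ℝ)) (b := 1)
      (fun t ht => (h1 t ht).continuousAt.continuousWithinAt)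
      (fun t ht => (h1 t ⟨ht.1, ht.2.le⟩).hasDerivWithinAt) 1 ⟨zero_le_one, le_rfl⟩
    rw [← h]
    exact Units.ext this
  exact mul_inv_eq_one.1 hc

end Segments

/-! ### Zero curvature from symmetry of second derivatives -/

section Flatness

variable {R : Type*} [NormedRing R] [NormedAlgebra ℝ R]

/-- The integrability condition for the system `∂₁ g = g a`, `∂ᵢ g = g b`. -/
theorem flat_of_fderiv_eq {g : ℂ → Rˣ} {a b : ℂ → R} {w : ℂ}
    (hg : ContDiffAt ℝ ∞ (fun u => (g u : R)) w) (ha : DifferentiableAt ℝ a w)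
    (hb : DifferentiableAt ℝ b w)
    (hga : ∀ᶠ u in 𝓝 w, fderiv ℝ (fun u => (g u : R)) u 1 = g u * a u)
    (hgb : ∀ᶠ u in 𝓝 w, fderiv ℝ (fun u => (g u : R)) u I = g u * b u) :
    fderiv ℝ b w 1 - fderiv ℝ a w I + (a w * b w - b w * a w) = 0 := by
  have hsymm : IsSymmSndFDerivAt ℝ (fun u => (g u : R)) w :=
    (contDiffAt_infty.1 hg 2).isSymmSndFDerivAt (by simp)
  have hg1 := (hg.differentiableAt (by simp)).hasFDerivAt
  have hg2 : DifferentiableAt ℝ (fderiv ℝ (fun u => (g u : R))) w :=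
    ((contDiffAt_infty.1 hg 2).fderiv_right (m := 1) (by norm_num)).differentiableAt (by simp)
  have key : ∀ (v z : ℂ) (k : ℂ → R), DifferentiableAt ℝ k w →
      (∀ᶠ u in 𝓝 w, fderiv ℝ (fun u => (g u : R)) u v = g u * k u) →
      fderiv ℝ (fderiv ℝ (fun u => (g u : R))) w z v =
        g w * fderiv ℝ k w z + fderiv ℝ (fun u => (g u : R)) w z * k w := by
    intro v z k hk h
    have h1 := (hg2.hasFDerivAt.clm_apply (hasFDerivAt_const v w)).fderiv
    have h2 := (hg1.mul' hk.hasFDerivAt).fderiv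
    have h3 : (fun u => fderiv ℝ (fun u => (g u : R)) u v) =ᶠ[𝓝 w] (fun u => (g u : R)) * k := h
    have h4 := h3.fderiv_eq (𝕜 := ℝ)
    rw [h1, h2] at h4
    simpa using congrArg (fun L : ℂ →L[ℝ] R => L z) h4
  have e := hsymm 1 I
  rw [key I 1 b hb hgb, key 1 I a ha hga, hga.self_of_nhds, hgb.self_of_nhds] at e
  have e2 : (g w : R) * (fderiv ℝ b w 1 - fderiv ℝ a w I + (a w * b w - b w * a w)) = 0 := by
    rw [← sub_eq_zero] at e
    rw [← e]
    noncomm_ring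
  rw [← Units.inv_mul_cancel_left (g w)
    (fderiv ℝ b w 1 - fderiv ℝ a w I + (a w * b w - b w * a w)), e2, mul_zero]

end Flatness

/-! ### Harmonicity from Uhlenbeck's system -/

section Harmonic

variable {V : Type*} [NormedAddCommGroup V] [NormedSpace ℂ V]
  {X : Type*} [TopologicalSpace X] [ChartedSpace ℂ X]

theorem part10_add_part01 (β : ℂ → Mat V) (v : ℂ) : part10 β v + part01 β v = β v := by
  unfold part10 part01
  module

variable [IsManifold 𝓘(ℂ) ω X]

theorem mcChart_eq_maurerCartan {f : X → GLin V} (hf : SmoothOn f univ)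
    {e : OpenPartialHomeomorph X ℂ} (he : e ∈ atlas ℂ X) {w : ℂ} (hw : w ∈ e.target) (v : ℂ) :
    mcChart e f v w = maurerCartan f (e.symm w) (chartVelocity e w * v) := by
  unfold mcChart maurerCartan
  rw [(hasFDerivAt_comp_chart_symm hf he hw).2]

theorem differentiableAt_mcChart [CompleteSpace V] {f : X → GLin V} (hf : SmoothOn f univ)
    {e : OpenPartialHomeomorph X ℂ} (he : e ∈ atlas ℂ X) {w : ℂ} (hw : w ∈ e.target) (v : ℂ) :
    DifferentiableAt ℝ (mcChart e f v) w := by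
  have h := (hasFDerivAt_comp_chart_symm hf he hw).1
  have h1 : DifferentiableAt ℝ (fun u => (((f (e.symm u))⁻¹ : GLin V) : Mat V)) w :=
    (contDiffAt_units_inv h).differentiableAt (by simp)
  have h2 : DifferentiableAt ℝ (fderiv ℝ fun u => (f (e.symm u) : Mat V)) w :=
    ((contDiffAt_infty.1 h 2).fderiv_right (m := 1) (by norm_num)).differentiableAt (by simp)
  exact h1.mul (h2.clm_apply (differentiableAt_const v))

/-- Uhlenbeck's system in a chart. -/
theorem SolvesUhlenbeck.fderiv_eq {f : X → GLin V} {Φ : X → ℂˣ → GLin V}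
    (hΦ : SolvesUhlenbeck f Φ) (hf : SmoothOn f univ)
    {e : OpenPartialHomeomorph X ℂ} (he : e ∈ atlas ℂ X) {w : ℂ} (hw : w ∈ e.target)
    (l : ℂˣ) (v : ℂ) :
    fderiv ℝ (fun u => (Φ (e.symm u) l : Mat V)) w v = Φ (e.symm w) l *
      ((1 - (l : ℂ)⁻¹) • (1 / 4 : ℂ) • (mcChart e f v w - I • mcChart e f (I * v) w) +
        (1 - (l : ℂ)) • (1 / 4 : ℂ) • (mcChart e f v w + I • mcChart e f (I * v) w)) := by
  rw [(hasFDerivAt_comp_chart_symm (hΦ.smooth l) he hw).2,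
    ← part10_add_part01 (fun u => diff (fun y => Φ y l) (e.symm w) u), hΦ.eqn10, hΦ.eqn01,
    ← mul_smul_comm, ← mul_smul_comm, ← mul_add, mcChart_eq_maurerCartan hf he hw,
    mcChart_eq_maurerCartan hf he hw, mul_left_comm _ I]
  unfold part10 part01
  congr 1
  module

/-- A map for which Uhlenbeck's system is solvable is harmonic. -/
theorem SolvesUhlenbeck.isHarmonic [CompleteSpace V] {G : Subgroup (GLin V)} {f : X → GLin V}
    {Φ : X → ℂˣ → GLin V} (hΦ : SolvesUhlenbeck f Φ) (hf : SmoothOn f univ)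
    (hG : ∀ x, f x ∈ G) : IsHarmonicIntoGroup G f := by
  refine ⟨hG, hf, fun e he w hw => ?_⟩
  have hnear : ∀ᶠ u in 𝓝 w, u ∈ e.target := e.open_target.mem_nhds hw
  set m := mcChart e f 1
  set n := mcChart e f I
  have hm : DifferentiableAt ℝ m w := differentiableAt_mcChart hf he hw 1
  have hn : DifferentiableAt ℝ n w := differentiableAt_mcChart hf he hw I
  have hII : ∀ u, mcChart e f (I * I) u = -m u := by
    intro u
    simp only [m, mcChart]
    rw [I_mul_I, map_neg, mul_neg]
  -- At `λ = s i` with `s = ±1` the connection has the real coefficients `(m + s n) / 2` and `(n - s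
  -- m) / 2`, whose commutator `[m, n] / 2` does not depend on `s`.
  have key : ∀ (l : ℂˣ) (s : ℝ), (l : ℂ) = s * I → s * s = 1 →
      fderiv ℝ ((1 / 2 : ℝ) • (n - s • m)) w 1 - fderiv ℝ ((1 / 2 : ℝ) • (m + s • n)) w I +
      (((1 / 2 : ℝ) • (m + s • n)) w * ((1 / 2 : ℝ) • (n - s • m)) w -
        ((1 / 2 : ℝ) • (n - s • m)) w * ((1 / 2 : ℝ) • (m + s • n)) w) = 0 := by
    intro l s hl hs
    have hs' : (s : ℂ) * s = 1 := by exact_mod_cast hs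
    have hli : (l : ℂ)⁻¹ = -(s * I) := by
      rw [hl]
      refine inv_eq_of_mul_eq_one_right ?_
      linear_combination (-(s : ℂ) * s) * I_mul_I + hs'
    refine flat_of_fderiv_eq (g := fun u => Φ (e.symm u) l)
      (hasFDerivAt_comp_chart_symm (hΦ.smooth l) he hw).1 ((hm.add (hn.const_smul s)).const_smul _)
      ((hn.sub (hm.const_smul s)).const_smul _) ?_ ?_
    · filter_upwards [hnear] with u hu
      rw [hΦ.fderiv_eq hf he hu, hli, hl, mul_one]
      congr 1
      change _ = (1 / 2 : ℝ) • (m u + s • n u)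
      simp only [← Complex.coe_smul]
      match_scalars
      · ring
      · linear_combination (-(s : ℂ) / 2) * I_mul_I
    · filter_upwards [hnear] with u hu
      rw [hΦ.fderiv_eq hf he hu, hli, hl, hII]
      congr 1
      change _ = (1 / 2 : ℝ) • (n u - s • m u)
      simp only [← Complex.coe_smul]
      match_scalars
      · ring
      · linear_combination ((s : ℂ) / 2) * I_mul_I
  have k1 := key ⟨I, -I, by simp, by simp⟩ 1 (by simp) (by simp)
  have k2 := key ⟨-I, I, by simp, by simp⟩ (-1) (by simp) (by simp)
  have d1 : ∀ s : ℝ, fderiv ℝ ((1 / 2 : ℝ) • (n - s • m)) w 1 =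
      (1 / 2 : ℝ) • (fderiv ℝ n w 1 - s • fderiv ℝ m w 1) := by
    intro s
    rw [fderiv_const_smul (hn.sub (hm.const_smul s)), fderiv_sub hn (hm.const_smul s),
      fderiv_const_smul hm]
    rfl
  have d2 : ∀ s : ℝ, fderiv ℝ ((1 / 2 : ℝ) • (m + s • n)) w I =
      (1 / 2 : ℝ) • (fderiv ℝ m w I + s • fderiv ℝ n w I) := by
    intro s
    rw [fderiv_const_smul (hm.add (hn.const_smul s)), fderiv_add hm (hn.const_smul s),
      fderiv_const_smul hn]
    rfl
  rw [d1, d2] at k1 k2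
  simp only [Pi.smul_apply, Pi.add_apply, Pi.sub_apply, smul_mul_smul_comm, one_smul, neg_smul,
    sub_neg_eq_add, ← sub_eq_add_neg] at k1 k2
  -- Subtracting the two curvature equations cancels the commutator and the terms even in `s`,
  -- leaving `∂₁ m + ∂ᵢ n`.
  have k3 := sub_eq_zero.2 (k2.trans k1.symm)
  rw [← k3]
  simp only [mul_add, add_mul, mul_sub, sub_mul]
  module

end Harmonic

/-! ### Extended frames and the modified map -/

section Frames

variable {V : Type*} [NormedAddCommGroup V] [NormedSpace ℂ V] {G : Subgroup (GLin V)} {h : G}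

/-- `σ²` is conjugation by `h²`, so `σ² = id` makes `h²` central. -/
theorem mul_self_eq_one_of_sigma_involutive (hG : Subgroup.center G = ⊥)
    (hσ : ∀ g : G, sigma h (sigma h g) = g) : (h : GLin V) * h = 1 := by
  have hc : h * h ∈ Subgroup.center G := by
    rw [Subgroup.mem_center_iff]
    intro g
    have := hσ g
    simp only [sigma, MulAut.conj_apply] at this
    nth_rw 1 [← this]
    group
  rw [hG, Subgroup.mem_bot] at hc
  exact congrArg Subtype.val hc

theorem kPart_add_pPart (Y : Mat V) : kPart h Y + pPart h Y = Y := by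
  unfold kPart pPart
  module

theorem continuous_pPart : Continuous (pPart h : Mat V → Mat V) := by
  unfold pPart dsigma
  fun_prop

theorem continuous_kPart : Continuous (kPart h : Mat V → Mat V) := by
  unfold kPart dsigma
  fun_prop

theorem dsigma_dsigma (hh : (h : GLin V) * h = 1) (Y : Mat V) : dsigma h (dsigma h Y) = Y := by
  have h1 : (((h : GLin V) : Mat V)) * ((h : GLin V) : Mat V) = 1 := by
    rw [← Units.val_mul, hh, Units.val_one]
  have h2 : (h : GLin V)⁻¹ = h := inv_eq_of_mul_eq_one_left hh
  unfold dsigma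
  rw [h2, mul_assoc, mul_assoc, mul_assoc, h1, mul_one, ← mul_assoc, h1, one_mul]

theorem dsigma_add (Y Z : Mat V) : dsigma h (Y + Z) = dsigma h Y + dsigma h Z := by
  simp only [dsigma, mul_add, add_mul]

theorem dsigma_sub (Y Z : Mat V) : dsigma h (Y - Z) = dsigma h Y - dsigma h Z := by
  simp only [dsigma, mul_sub, sub_mul]

theorem dsigma_smul (a : ℂ) (Y : Mat V) : dsigma h (a • Y) = a • dsigma h Y := by
  simp only [dsigma, mul_smul_comm, smul_mul_assoc]

theorem dsigma_kPart (hh : (h : GLin V) * h = 1) (Y : Mat V) : dsigma h (kPart h Y) = kPart h Y := by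
  unfold kPart
  rw [dsigma_smul, dsigma_add, dsigma_dsigma hh, add_comm]

theorem dsigma_pPart (hh : (h : GLin V) * h = 1) (Y : Mat V) :
    dsigma h (pPart h Y) = -pPart h Y := by
  unfold pPart
  rw [dsigma_smul, dsigma_sub, dsigma_dsigma hh]
  module

theorem kPart_mem_tangentSet {Y : Mat V} (hY : Y ∈ tangentSet G) : kPart h Y ∈ tangentSet G := by
  have := tangentSet_smul (1 / 2) (tangentSet_add hY (tangentSet_conj h.2 hY))
  rw [← Complex.coe_smul] at this
  simpa [kPart, dsigma] using this

theorem pPart_mem_tangentSet {Y : Mat V} (hY : Y ∈ tangentSet G) : pPart h Y ∈ tangentSet G := by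
  have := tangentSet_smul (1 / 2)
    (tangentSet_add hY (tangentSet_smul (-1) (tangentSet_conj h.2 hY)))
  rw [← Complex.coe_smul] at this
  simpa [pPart, dsigma, sub_eq_add_neg] using this

variable {X : Type*} [TopologicalSpace X] [ChartedSpace ℂ X]

theorem maurerCartan_mem_tangentSet {f : X → G}
    (hf : SmoothOn (fun y => (f y : GLin V)) univ) (x : X) (v : ℂ) :
    maurerCartan (fun y => (f y : GLin V)) x v ∈ tangentSet G := by
  set e := chartAt ℂ x
  -- For large `t` the line may leave the target of the chart, which is harmless: `f` has values in
  -- `G` everywhere, and differentiability is required only at `0`.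
  refine ⟨fun t => (f x : GLin V)⁻¹ * f (e.symm (e x + t • v)),
    fun t => G.mul_mem (G.inv_mem (f x).2) (f _).2, ?_, ?_⟩
  · simp [e, (chartAt ℂ x).left_inv (mem_chart_source ℂ x)]
  · have h1 := ((smoothOn_univ_iff.1 hf x).2.differentiableAt (by simp)).hasFDerivAt
    have hl : HasDerivAt (fun t : ℝ => e x + t • v) v 0 := by
      simpa using ((hasDerivAt_id (0 : ℝ)).smul_const v).const_add (e x)
    have h1' : HasFDerivAt (fun u => (f (e.symm u) : GLin V).val)
        (diff (fun y => (f y : GLin V)) x) (e x + (0 : ℝ) • v) := by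
      rw [diff_eq_fderiv hf, zero_smul, add_zero]
      exact h1
    exact (h1'.comp_hasDerivAt (0 : ℝ) hl).const_mul (((f x : GLin V)⁻¹ : GLin V) : Mat V)

/-- Written this way, the coefficients of the `𝔭`-terms become `Re λ` and `-Im λ` when `|λ| = 1`, so
the form is visibly real on the circle. -/
theorem alphaLoop_eq (f : X → G) (l : ℂˣ) (x : X) (v : ℂ) :
    alphaLoop h f l x v = kPart h (maurerCartan (fun y => (f y : GLin V)) x v) +
      (((l : ℂ)⁻¹ + l) / 2) • pPart h (maurerCartan (fun y => (f y : GLin V)) x v) +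
      (I * (l - (l : ℂ)⁻¹) / 2) • pPart h (maurerCartan (fun y => (f y : GLin V)) x (I * v)) := by
  unfold alphaLoop part10 part01
  module

theorem alphaLoop_one (f : X → G) (x : X) (v : ℂ) :
    alphaLoop h f 1 x v = maurerCartan (fun y => (f y : GLin V)) x v := by
  rw [alphaLoop_eq]
  simp [kPart_add_pPart]

theorem alphaLoop_mem_tangentSet {f : X → G} (hf : SmoothOn (fun y => (f y : GLin V)) univ)
    (l : Circle) (x : X) (v : ℂ) : alphaLoop h f (Circle.toUnits l) x v ∈ tangentSet G := by
  rw [alphaLoop_eq]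
  have hα := maurerCartan_mem_tangentSet hf x
  have hl : ((Circle.toUnits l : ℂˣ) : ℂ)⁻¹ = (starRingEnd ℂ) (l : ℂ) := by
    rw [Circle.toUnits_apply]
    simpa using Circle.coe_inv_eq_conj l
  have h1 : (((Circle.toUnits l : ℂˣ) : ℂ)⁻¹ + (Circle.toUnits l : ℂˣ)) / 2 = ((l : ℂ).re : ℂ) := by
    rw [hl]
    apply Complex.ext <;> simp
  have h2 : I * ((Circle.toUnits l : ℂˣ) - ((Circle.toUnits l : ℂˣ) : ℂ)⁻¹) / 2 =
      ((-(l : ℂ).im : ℝ) : ℂ) := by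
    rw [hl]
    apply Complex.ext <;> simp
  rw [h1, h2, Complex.coe_smul, Complex.coe_smul]
  exact tangentSet_add (tangentSet_add (kPart_mem_tangentSet (hα v))
    (tangentSet_smul _ (pPart_mem_tangentSet (hα v))))
    (tangentSet_smul _ (pPart_mem_tangentSet (hα _)))

theorem IsVelocity.continuousOn_maurerCartan [CompleteSpace V] {c : ℝ → X} {τ : ℝ → ℂ}
    (hc : IsVelocity V c τ) {f : X → GLin V} (hf : SmoothOn f univ) (z : ℂ) :
    ContinuousOn (fun t => maurerCartan f (c t) (z * τ t)) (Icc 0 1) :=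
  ContinuousOn.mul (fun t ht => ((hc _ hf.inv).1 t ht).continuousAt.continuousWithinAt)
    ((hc f hf).2 z)

theorem IsVelocity.continuousOn_kPart [CompleteSpace V] {c : ℝ → X} {τ : ℝ → ℂ}
    (hc : IsVelocity V c τ) {f : X → GLin V} (hf : SmoothOn f univ) :
    ContinuousOn (fun t => kPart h (maurerCartan f (c t) (τ t))) (Icc 0 1) := by
  have h1 := hc.continuousOn_maurerCartan hf 1
  simp only [one_mul] at h1
  exact continuous_kPart.comp_continuousOn h1

theorem IsVelocity.continuousOn_pPart [CompleteSpace V] {c : ℝ → X} {τ : ℝ → ℂ}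
    (hc : IsVelocity V c τ) {f : X → GLin V} (hf : SmoothOn f univ) :
    ContinuousOn (fun t => pPart h (maurerCartan f (c t) (τ t))) (Icc 0 1) ∧
      ContinuousOn (fun t => pPart h (maurerCartan f (c t) (I * τ t))) (Icc 0 1) := by
  have h1 := hc.continuousOn_maurerCartan hf 1
  simp only [one_mul] at h1
  exact ⟨continuous_pPart.comp_continuousOn h1,
    continuous_pPart.comp_continuousOn (hc.continuousOn_maurerCartan hf I)⟩

theorem diff_conj {f : X → GLin V} (hf : SmoothOn f univ) (g : GLin V) (x : X) (v : ℂ) :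
    diff (fun y => g * f y * g⁻¹) x v = g * diff f x v * (g⁻¹ : GLin V) := by
  rw [diff_mul ((smoothOn_const g).mul hf) (smoothOn_const g⁻¹), diff_mul (smoothOn_const g) hf,
    diff_const, diff_const]
  simp

variable [CompleteSpace V] {f : X → G} {x₀ : X} {F : X → ℂˣ → GLin V}

theorem smoothOn_modifiedMap (hF : IsExtendedFrame h f x₀ F) :
    SmoothOn (modifiedMap h F) univ :=
  ((hF.smooth 1).mul (smoothOn_const _)).mul (hF.smooth 1).inv

/-- `d(F h F⁻¹) = F [α, h] F⁻¹`, and multiplying by `𝔽⁻¹ = F h F⁻¹` gives `F (h α h - α) F⁻¹`, where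
`h α h = dσ α`. -/
theorem maurerCartan_modifiedMap (hF : IsExtendedFrame h f x₀ F) (hh : (h : GLin V) * h = 1)
    (x : X) (v : ℂ) : maurerCartan (modifiedMap h F) x v =
      (-2 : ℂ) • ((F x 1 : Mat V) * pPart h (maurerCartan (fun y => (f y : GLin V)) x v) *
        ((F x 1)⁻¹ : GLin V)) := by
  have h2 : (h : GLin V)⁻¹ = h := inv_eq_of_mul_eq_one_left hh
  have hd : diff (modifiedMap h F) x v = (F x 1 : Mat V) *
      (maurerCartan (fun y => (f y : GLin V)) x v * (h : GLin V) -
        (h : GLin V) * maurerCartan (fun y => (f y : GLin V)) x v) * ((F x 1)⁻¹ : GLin V) := by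
    unfold modifiedMap
    rw [diff_mul ((hF.smooth 1).mul (smoothOn_const _)) (hF.smooth 1).inv,
      diff_mul (hF.smooth 1) (smoothOn_const _), diff_inv (hF.smooth 1), diff_const, hF.eqn,
      alphaLoop_one, Units.inv_mul_cancel_left]
    push_cast
    noncomm_ring
  have hi : ((modifiedMap h F x)⁻¹ : GLin V) = F x 1 * (h : GLin V) * (F x 1)⁻¹ := by
    simp [modifiedMap, h2, mul_assoc]
  have hhv : ((h : GLin V) : Mat V) * ((h : GLin V) : Mat V) = 1 := by
    rw [← Units.val_mul, hh, Units.val_one]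
  unfold maurerCartan at hd ⊢
  rw [hd, hi]
  set α : Mat V := (((f x : GLin V)⁻¹ : GLin V) : Mat V) * diff (fun y => (f y : GLin V)) x v
  have hp : pPart h α = (1 / 2 : ℂ) • (α - (h : GLin V) * α * (h : GLin V)) := by
    rw [pPart, dsigma, h2]
  rw [hp, mul_smul_comm, smul_mul_assoc, smul_smul]
  push_cast
  have e1 : (F x 1 : Mat V) * (h : GLin V) * ((F x 1)⁻¹ : GLin V) * ((F x 1 : Mat V) *
      (α * (h : GLin V) - (h : GLin V) * α) * ((F x 1)⁻¹ : GLin V)) =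
      (F x 1 : Mat V) * ((h : GLin V) * (((F x 1)⁻¹ : GLin V) * ((F x 1 : Mat V) *
      (α * (h : GLin V) - (h : GLin V) * α)))) * ((F x 1)⁻¹ : GLin V) := by
    noncomm_ring
  rw [e1, Units.inv_mul_cancel_left, mul_sub, ← mul_assoc ((h : GLin V) : Mat V) (h : GLin V), hhv,
    one_mul]
  rw [show (-2 : ℂ) * (1 / 2) = -1 by norm_num, neg_one_smul]
  noncomm_ring

variable [IsManifold 𝓘(ℂ) ω X] [ConnectedSpace X]

/-- The extended frame has values in `G` for unimodular `l`. -/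
theorem IsExtendedFrame.mem (hF : IsExtendedFrame h f x₀ F) (hG : IsClosed (G : Set (GLin V)))
    (hf : SmoothOn (fun y => (f y : GLin V)) univ) (l : Circle) (x : X) :
    F x (Circle.toUnits l) ∈ G := by
  refine path_induction (V := V) (P := fun x => F x (Circle.toUnits l) ∈ G) (x₀ := x₀)
    (by rw [hF.base]; exact G.one_mem) (fun c τ hc h0 => ?_) x
  refine mem_of_hasDerivAt_tangentSet hG (γ := fun t => F (c t) (Circle.toUnits l))
    (a := fun t => alphaLoop h f (Circle.toUnits l) (c t) (τ t)) (fun t ht => ?_) ?_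
    (fun t _ => alphaLoop_mem_tangentSet hf l _ _) h0
  · rw [← hF.eqn]
    exact (hc _ (hF.smooth _)).1 t ht
  · simp only [alphaLoop_eq]
    obtain ⟨p1, p2⟩ := hc.continuousOn_pPart (h := h) hf
    have k1 := hc.continuousOn_kPart (h := h) hf
    exact (k1.fun_add (p1.fun_const_smul _)).fun_add (p2.fun_const_smul _)

/-- The extension by `1` of a map on `ℂ^*` to `ℂ`. -/
def extendByOne (γ : ℂˣ → GLin V) (z : ℂ) : GLin V :=
  if hz : z ≠ 0 then γ (Units.mk0 z hz) else 1

/-- The extended frame depends holomorphically on `l`. -/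
theorem IsExtendedFrame.differentiableAt (hF : IsExtendedFrame h f x₀ F)
    (hf : SmoothOn (fun y => (f y : GLin V)) univ) (x : X) {z : ℂ} (hz : z ≠ 0) :
    DifferentiableAt ℂ (fun w => (extendByOne (F x) w : Mat V)) z := by
  refine path_induction (V := V) (P := fun x => ∀ z : ℂ, z ≠ 0 →
    DifferentiableAt ℂ (fun w => (extendByOne (F x) w : Mat V)) z) (x₀ := x₀)
    (fun z _ => ?_) (fun c τ hc h0 z hz => ?_) x z hz
  · have : extendByOne (F x₀) = fun _ => 1 := by
      funext w
      simp [extendByOne, hF.base]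
    rw [this]
    exact differentiableAt_const _
  obtain ⟨p1, p2⟩ := hc.continuousOn_pPart (h := h) hf
  have k1 := hc.continuousOn_kPart (h := h) hf
  have hb : ContinuousOn (fun t => part10
      (fun u => pPart h (maurerCartan (fun y => (f y : GLin V)) (c t) u)) (τ t)) (Icc 0 1) :=
    (p1.fun_sub (p2.fun_const_smul I)).fun_const_smul _
  have hd : ContinuousOn (fun t => part01
      (fun u => pPart h (maurerCartan (fun y => (f y : GLin V)) (c t) u)) (τ t)) (Icc 0 1) :=
    (p1.fun_add (p2.fun_const_smul I)).fun_const_smul _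
  -- Left multiplication by the inverse of the value at `c 0` normalizes the solution to start at
  -- `1` and preserves the equation.
  have key := differentiableAt_of_hasDerivAt_parameter
    (T := fun s w => (extendByOne (F (c 0)) w)⁻¹ * extendByOne (F (c s)) w)
    (fun w hw t ht => by
      simp only [extendByOne, dif_pos hw, Units.val_mul, mul_assoc]
      refine HasDerivAt.const_mul _ ?_
      have := (hc _ (hF.smooth (Units.mk0 w hw))).1 t ht
      rw [hF.eqn] at this
      exact this)
    hb k1 hd (fun w => inv_mul_cancel _) hz
  have := (h0 z hz).mul key
  refine this.congr_of_eventuallyEq (Eventually.of_forall fun w => ?_)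
  simp

/-- A holomorphic function on `ℂ^*` is smooth, and so is its composition with `θ ↦ exp (iθ)`. -/
theorem IsExtendedFrame.onCircle_mem_loopGroup [FiniteDimensional ℂ V]
    (hF : IsExtendedFrame h f x₀ F) (hG : IsClosed (G : Set (GLin V)))
    (hf : SmoothOn (fun y => (f y : GLin V)) univ) (x : X) : onCircle (F x) ∈ loopGroup G := by
  refine ⟨fun l => hF.mem hG hf l x, ?_⟩
  have h1 : ContDiffOn ℂ ∞ (fun w => (extendByOne (F x) w : Mat V)) {0}ᶜ :=
    DifferentiableOn.contDiffOn
      (fun z hz => (hF.differentiableAt hf x hz).differentiableWithinAt) isOpen_compl_singleton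
  have h2 : (fun θ : ℝ => (onCircle (F x) (Circle.exp θ) : Mat V)) =
      (fun w => (extendByOne (F x) w : Mat V)) ∘ fun θ : ℝ => Complex.exp (θ * I) := by
    funext θ
    simp only [onCircle, Function.comp_apply, extendByOne, dif_pos (Complex.exp_ne_zero (θ * I)),
      ne_eq]
    congr 2
  rw [h2, contDiff_iff_contDiffAt]
  intro θ
  have h3 : ContDiff ℝ ∞ fun θ : ℝ => Complex.exp (θ * I) :=
    (Complex.ofRealCLM.contDiff.mul contDiff_const).cexp
  exact ((h1.contDiffAt (isOpen_compl_singleton.mem_nhds (Complex.exp_ne_zero _))).restrict_scalars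
    ℝ).comp θ h3.contDiffAt

/-- `dσ` fixes `α_𝔨` and negates `α_𝔭`, so it carries `α_λ` to `α_{-λ}`; both sides then solve the
same equation and equal `1` at `x₀`. -/
theorem IsExtendedFrame.twisted (hF : IsExtendedFrame h f x₀ F) (hh : (h : GLin V) * h = 1)
    (l : ℂˣ) (x : X) : (h : GLin V) * F x l * (h : GLin V)⁻¹ = F x (-l) := by
  refine eq_of_diff_eq_mul (f := fun x => (h : GLin V) * F x l * (h : GLin V)⁻¹)
    (g := fun x => F x (-l)) (x₀ := x₀) (β := alphaLoop h f (-l))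
    (((smoothOn_const _).mul (hF.smooth l)).mul (smoothOn_const _)) (hF.smooth _)
    (fun y v => ?_) (hF.eqn _) (by simp [hF.base]) x
  rw [diff_conj (hF.smooth l), hF.eqn]
  have hα : alphaLoop h f (-l) y v = dsigma h (alphaLoop h f l y v) := by
    simp only [alphaLoop_eq, dsigma_add, dsigma_smul, dsigma_kPart hh, dsigma_pPart hh,
      Units.val_neg, inv_neg]
    module
  rw [hα]
  simp [dsigma, mul_assoc]

theorem SolvesUhlenbeck.eq_mul_extendedFrame {Φ : X → ℂˣ → GLin V}
    (hΦ : SolvesUhlenbeck (modifiedMap h F) Φ) (hF : IsExtendedFrame h f x₀ F)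
    (hh : (h : GLin V) * h = 1) (x : X) (l : ℂˣ) : Φ x l = Φ x₀ l * F x l * (F x 1)⁻¹ := by
  refine eq_of_diff_eq_mul (f := fun x => Φ x l) (g := fun x => Φ x₀ l * F x l * (F x 1)⁻¹)
    (x₀ := x₀) (β := fun x v => (F x 1 : Mat V) * (alphaLoop h f l x v - alphaLoop h f 1 x v) *
      ((F x 1)⁻¹ : GLin V))
    (hΦ.smooth l) (((smoothOn_const _).mul (hF.smooth l)).mul (hF.smooth 1).inv)
    (fun y v => ?_) (fun y v => ?_) (by simp [hF.base]) x
  · rw [← part10_add_part01 (fun u => diff (fun y => Φ y l) y u), hΦ.eqn10, hΦ.eqn01,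
      ← mul_smul_comm, ← mul_smul_comm, ← mul_add]
    congr 1
    -- With `𝔸 = -F α_𝔭 F⁻¹` the claim is `-(1 - λ⁻¹) α_𝔭' - (1 - λ) α_𝔭'' = α_λ - α_1`, conjugated
    -- by `F`.
    simp only [maurerCartan_modifiedMap hF hh]
    unfold part10 part01
    simp only [alphaLoop_eq, mul_add, add_mul, mul_sub, sub_mul, mul_smul_comm, smul_mul_assoc,
      Units.val_one, inv_one]
    module
  · rw [diff_mul ((smoothOn_const _).mul (hF.smooth l)) (hF.smooth 1).inv,
      diff_mul (smoothOn_const _) (hF.smooth l), diff_inv (hF.smooth 1), diff_const, hF.eqn,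
      hF.eqn, Units.inv_mul_cancel_left]
    have : ∀ Y : Mat V, ((Φ x₀ l * F y l * (F y 1)⁻¹ : GLin V) : Mat V) * ((F y 1 : Mat V) * Y *
        ((F y 1)⁻¹ : GLin V)) = Φ x₀ l * F y l * Y * ((F y 1)⁻¹ : GLin V) := by
      intro Y
      simp [mul_assoc]
    rw [this]
    push_cast
    noncomm_ring

end Frames

end HarmonicLoop

end

/-! ### Assembly of the four conclusions -/

open HarmonicLoop in
theorem mainTheorem11 {V : Type*} [NormedAddCommGroup V] [NormedSpace ℂ V]
    [FiniteDimensional ℂ V] (G : Subgroup (GLin V)) (hG : IsSemisimpleMatrixGroup G)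
    (h : G) (hσ : ∀ g : G, sigma h (sigma h g) = g)
    {M : Type*} [TopologicalSpace M] [ChartedSpace ℂ M] [IsManifold 𝓘(ℂ) ω M]
    (φ : M → G ⧸ fixSigma h) (hφ : IsHarmonicIntoSymmetricSpace h φ)
    {X : Type*} [TopologicalSpace X] [ChartedSpace ℂ X] [IsManifold 𝓘(ℂ) ω X] [ConnectedSpace X]
    (p : X → M) (hp : MDifferentiable 𝓘(ℂ) 𝓘(ℂ) p) (x₀ : X)
    (f : X → G) (hf : IsFrame h (φ ∘ p) x₀ f)
    (F : X → ℂˣ → GLin V) (hF : IsExtendedFrame h f x₀ F)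
    (Φ : X → ℂˣ → GLin V) (hΦ : SolvesUhlenbeck (modifiedMap h F) Φ)
    (hΦ₀ : onCircle (Φ x₀) ∈ basedLoopGroup G) (hΦ₁ : Φ x₀ (-1) = h)
    (A : ℂˣ → GLin V) (hA : ∀ l, A l = (Φ x₀ l)⁻¹) :
    (∀ x, onCircle (F x) ∈ loopGroup G ∧ IsTwisted h (onCircle (F x))) ∧
    IsModifiedHarmonicMap h x₀ (modifiedMap h F) ∧
    (∀ x l, Φ x l = (A l)⁻¹ * F x l * (F x 1)⁻¹) ∧
    (∀ x, onCircle (Φ x) ∈ basedLoopGroup G) ∧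
    (∀ x, Φ x (-1) = modifiedMap h F x) := by
  have hh := mul_self_eq_one_of_sigma_involutive hG.center_trivial hσ
  have hloop := hF.onCircle_mem_loopGroup hG.closed hf.smooth
  have h1 : ∀ x, F x 1 ∈ G := fun x => by simpa using hF.mem hG.closed hf.smooth 1 x
  have hΦF : ∀ x l, Φ x l = Φ x₀ l * F x l * (F x 1)⁻¹ := hΦ.eq_mul_extendedFrame hF hh
  have hneg : ∀ l : Circle, Circle.toUnits (-l) = -Circle.toUnits l := fun l => by
    ext
    simp
  refine ⟨fun x => ⟨hloop x, fun l => ?_⟩, ⟨?_, fun x => ?_, ?_⟩, fun x l => ?_, fun x => ?_,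
    fun x => ?_⟩
  · simp only [onCircle]
    rw [hF.twisted hh, hneg]
  · exact hΦ.isHarmonic (smoothOn_modifiedMap hF)
      fun x => G.mul_mem (G.mul_mem (h1 x) h.2) (G.inv_mem (h1 x))
  · calc F x 1 * (h : GLin V) * (F x 1)⁻¹ * (F x 1 * (h : GLin V) * (F x 1)⁻¹)
        = F x 1 * ((h : GLin V) * h) * (F x 1)⁻¹ := by group
      _ = 1 := by rw [hh]; group
  · simp [modifiedMap, hF.base]
  · rw [hA, inv_inv, hΦF]
  · have hc : (fun _ : Circle => (F x 1)⁻¹) ∈ loopGroup G :=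
      ⟨fun _ => G.inv_mem (h1 x), contDiff_const⟩
    have he : onCircle (Φ x) = onCircle (Φ x₀) * onCircle (F x) * fun _ => (F x 1)⁻¹ :=
      funext fun l => hΦF x _
    rw [he]
    refine ⟨Subgroup.mul_mem _ (Subgroup.mul_mem _ hΦ₀.1 (hloop x)) hc, ?_⟩
    have := hΦ₀.2
    simp only [onCircle, map_one] at this
    simp [onCircle, this]
  -- `Φ(x, -1) = h F(x, -1) F(x, 1)⁻¹ = h (h F(x, 1) h⁻¹) F(x, 1)⁻¹`, and `h² = 1`.
  · rw [hΦF, hΦ₁, ← hF.twisted hh]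
    have hi : (h : GLin V)⁻¹ = h := inv_eq_of_mul_eq_one_left hh
    rw [hi, ← mul_assoc, ← mul_assoc, hh, one_mul]
    rfl
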